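/- Let $r,n\ge 0$ be integers, let $\mathrm{Sym}_n$ be the space of symmetric complex $n\times n$ matrices and $\mathrm{GL}_n$ the group of invertible ones, and let $C^\infty(\mathbb C^r,S)$ denote the set of holomorphic map-germs $(\mathbb C^r,0)\to S$ (the value at $0$ is arbitrary). Fix a volume form-germ $\Omega$ at $0\in\mathbb C^r$, i.e. a germ of a nowhere vanishing holomorphic $r$-form. A diffeomorphism-germ $\Phi:(\mathbb C^r,0)\to(\mathbb C^r,0)$ is a germ of a biholomorphic map with $\Phi(0)=0$. Germs $A,B\in C^\infty(\mathbb C^r,\mathrm{Sym}_n)$ are $\mathcal G$-equivalent if there are a diffeomorphism-germ $\Phi$ and $X\in C^\infty(\mathbb C^r,\mathrm{GL}_n)$ with $B=X^T(A\circ\Phi)X$. They are volume-preserving (unimodular) equivalent if $\Phi$ and $X$ can be chosen with, in addition, $\Phi^*\Omega=\Omega$. A germ $A\in C^\infty(\mathbb C^r,\mathrm{Sym}_n)$ is symmetrically quasi-homogeneous if there exist a holomorphic coordinate system $(x_1,\dots,x_r)$ on $(\mathbb C^r,0)$ (centred at $0$), non-negative integers $\lambda_1,\dots,\lambda_r$ with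 $\sum_{k=1}^r\lambda_k>0$, non-negative integers $\delta_1,\dots,\delta_n$, and $X\in C^\infty(\mathbb C^r,\mathrm{GL}_n)$ such that $B=X^TAX$, written in these coordinates, satisfies $$B_{ij}(t^{\lambda_1}x_1,\dots,t^{\lambda_r}x_r)=t^{\frac12(\delta_i+\delta_j)}B_{ij}(x_1,\dots,x_r)$$ as germs in $x$, for every $t\in\mathbb C$ and all $i,j=1,\dots,n$. (Here $0^0=1$, and $t^{\frac12(\delta_i+\delta_j)}$ is the principal branch; if $\delta_i+\delta_j$ is odd, the condition amounts to $B_{ij}=0$.) **Corollary.** Let $A\in C^\infty(\mathbb C^r,\mathrm{Sym}_n)$ be symmetrically quasi-homogeneous. If $B\in C^\infty(\mathbb C^r,\mathrm{Sym}_n)$ is $\mathcal G$-equivalent to $A$, then $B$ is volume-preserving equivalent to $A$. -/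

import Mathlib

open Filter Topology
open scoped Matrix

/-! Germs at the origin of `ℂ^r` are represented by functions on all of `ℂ^r`; every condition below
only concerns their behaviour near `0`, and equality of germs is eventual equality along `𝓝 0`.
In the complex setting "smooth" means holomorphic. -/

namespace SymGerm

/-- A holomorphic matrix-valued germ at `0` (holomorphic entry by entry). -/
def IsHolMatrixGerm {r n : ℕ} (A : (Fin r → ℂ) → Matrix (Fin n) (Fin n) ℂ) : Prop :=
  ∀ i j, AnalyticAt ℂ (fun x => A x i j) 0

/-- `A` represents a holomorphic map-germ from `(ℂ^r, 0)` to the symmetric matrices. -/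
structure IsSymGerm {r n : ℕ} (A : (Fin r → ℂ) → Matrix (Fin n) (Fin n) ℂ) : Prop where
  hol : IsHolMatrixGerm A
  symm : ∀ᶠ x in 𝓝 (0 : Fin r → ℂ), (A x).IsSymm

/-- `X` represents a holomorphic map-germ from `(ℂ^r, 0)` to the invertible matrices. -/
structure IsGLGerm {r n : ℕ} (X : (Fin r → ℂ) → Matrix (Fin n) (Fin n) ℂ) : Prop where
  hol : IsHolMatrixGerm X
  inv : ∀ᶠ x in 𝓝 (0 : Fin r → ℂ), IsUnit (X x)

/-- `Φ` represents a (bi)holomorphic diffeomorphism-germ `(ℂ^r, 0) → (ℂ^r, 0)`: a holomorphic germ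
fixing the origin which has a two-sided inverse germ of the same kind. -/
structure IsDiffeoGerm {r : ℕ} (Φ : (Fin r → ℂ) → (Fin r → ℂ)) : Prop where
  hol : AnalyticAt ℂ Φ 0
  map_zero : Φ 0 = 0
  exists_inv : ∃ Ψ : (Fin r → ℂ) → (Fin r → ℂ), AnalyticAt ℂ Ψ 0 ∧ Ψ 0 = 0 ∧
    (∀ᶠ x in 𝓝 (0 : Fin r → ℂ), Ψ (Φ x) = x) ∧ (∀ᶠ x in 𝓝 (0 : Fin r → ℂ), Φ (Ψ x) = x)

/-- `Ω` represents a volume form-germ at `0` on `ℂ^r`: a holomorphic nowhere vanishing form of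
top degree `r`. -/
structure IsVolumeFormGerm {r : ℕ} (Ω : (Fin r → ℂ) → (Fin r → ℂ) [⋀^Fin r]→L[ℂ] ℂ) : Prop where
  hol : AnalyticAt ℂ Ω 0
  ne_zero : ∀ᶠ x in 𝓝 (0 : Fin r → ℂ), Ω x ≠ 0

/-- The pullback `Φ^* Ω` of a differential form of degree `r`. -/
noncomputable def pullback {r : ℕ} (Φ : (Fin r → ℂ) → (Fin r → ℂ))
    (Ω : (Fin r → ℂ) → (Fin r → ℂ) [⋀^Fin r]→L[ℂ] ℂ) :
    (Fin r → ℂ) → (Fin r → ℂ) [⋀^Fin r]→L[ℂ] ℂ :=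
  fun x => (Ω (Φ x)).compContinuousLinearMap (fderiv ℂ Φ x)

/-- `A` and `B` are `𝒢`-equivalent: `B = Xᵀ (A ∘ Φ) X` as germs, for a diffeomorphism-germ `Φ` and a
germ `X` of invertible matrices. -/
def GEquiv {r n : ℕ} (A B : (Fin r → ℂ) → Matrix (Fin n) (Fin n) ℂ) : Prop :=
  ∃ (Φ : (Fin r → ℂ) → (Fin r → ℂ)) (X : (Fin r → ℂ) → Matrix (Fin n) (Fin n) ℂ),
    IsDiffeoGerm Φ ∧ IsGLGerm X ∧
      ∀ᶠ x in 𝓝 (0 : Fin r → ℂ), B x = (X x)ᵀ * A (Φ x) * X x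

/-- `A` and `B` are volume-preserving (unimodular) equivalent with respect to `Ω`: they are
`𝒢`-equivalent through a diffeomorphism-germ `Φ` with `Φ^* Ω = Ω`. -/
def VolEquiv {r n : ℕ} (Ω : (Fin r → ℂ) → (Fin r → ℂ) [⋀^Fin r]→L[ℂ] ℂ)
    (A B : (Fin r → ℂ) → Matrix (Fin n) (Fin n) ℂ) : Prop :=
  ∃ (Φ : (Fin r → ℂ) → (Fin r → ℂ)) (X : (Fin r → ℂ) → Matrix (Fin n) (Fin n) ℂ),
    IsDiffeoGerm Φ ∧ (∀ᶠ x in 𝓝 (0 : Fin r → ℂ), pullback Φ Ω x = Ω x) ∧ IsGLGerm X ∧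
      ∀ᶠ x in 𝓝 (0 : Fin r → ℂ), B x = (X x)ᵀ * A (Φ x) * X x

/-- `A` is symmetrically quasi-homogeneous. The germ `φ` sends the coordinates `(x₁, …, x_r)` to the
point with these coordinates, so that `B ∘ φ` is `B = Xᵀ A X` written in the coordinate system.
For each `t` the two sides are compared as germs in `x`. The power `t ^ ((δ i + δ j) / 2)` is the
complex one (principal branch); the branch only matters when `δ i + δ j` is odd, and then the
condition says that the entry `B i j` is zero. -/
def IsSymmQuasiHom {r n : ℕ} (A : (Fin r → ℂ) → Matrix (Fin n) (Fin n) ℂ) : Prop :=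
  ∃ (φ : (Fin r → ℂ) → (Fin r → ℂ)) (lam : Fin r → ℕ) (δ : Fin n → ℕ)
    (X B : (Fin r → ℂ) → Matrix (Fin n) (Fin n) ℂ),
    IsDiffeoGerm φ ∧ IsGLGerm X ∧ 0 < ∑ k, lam k ∧
      (∀ x, B x = (X x)ᵀ * A x * X x) ∧
      ∀ (t : ℂ) (i j : Fin n), ∀ᶠ x in 𝓝 (0 : Fin r → ℂ),
        B (φ (fun k => t ^ lam k * x k)) i j
          = t ^ (((δ i : ℂ) + (δ j : ℂ)) / 2) * B (φ x) i j

end SymGerm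

/-!
The group of variable dilations `x ↦ s(x) · x`, where `t · x = (t ^ w₁ x₁, …, t ^ w_r x_r)` and `s`
is a holomorphic unit, is large enough to carry any volume form to any other, and it does not change
the congruence class of a quasi-homogeneous matrix germ.

*Quasi-homogeneous germs.* If `C` is quasi-homogeneous with weights `λ` and exponents `δ`, take
`w = 2 λ`. Then `C (s · x) = D C(x) D` with `D = diag(s ^ δ_i)` uniformly near `0` for bounded `s`
(`eventually_dilate_two_mul_eq`); the factor `2` absorbs the half-integral exponents. One may
therefore substitute a function `s(x)` for the parameter (`eventually_rescale_eq_diagonal_mul`).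

*Volume forms.* Let `E = ∑ w_k x_k ∂_k` and `N = ∑ w_k > 0`. The Lie derivative along `E` of
`F dx₁ ∧ … ∧ dx_r` is `(E F + N F) dx₁ ∧ … ∧ dx_r`, and `E F + N F = f` is solved by
`F(x) = ∫₀¹ t ^ (N - 1) f(t · x) dt`. With `F` and `G` so obtained from the units `f` and `g`,
pulling `f dx₁ ∧ … ∧ dx_r` back to `g dx₁ ∧ … ∧ dx_r` by `x ↦ s(x) · x` amounts to the scalar
equation `F(s(x) · x) s(x) ^ N = G(x)`, which the implicit function theorem solves
(`exists_rescale_density`).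

Given `A = X₁ᵀ (B ∘ Φ) X₁` and quasi-homogeneous coordinates `φ` for `A`, choose the variable
dilation `θ` with `θ^* (Φ φ)^* Ω = φ^* Ω`. Then `Φ φ θ φ⁻¹` preserves `Ω`, and it still takes `B`
to a germ congruent to `A`.
-/

namespace SymGerm

/-! ### Weighted dilations and radial averages -/

/-- The weighted dilation `x ↦ (t ^ w₁ x₁, …, t ^ w_r x_r)`. -/
def dilate {r : ℕ} (w : Fin r → ℕ) (t : ℂ) (x : Fin r → ℂ) : Fin r → ℂ :=
  fun k => t ^ w k * x k

/-- The weighted dilation as a continuous linear map. -/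
noncomputable def dilateL {r : ℕ} (w : Fin r → ℕ) (t : ℂ) : (Fin r → ℂ) →L[ℂ] (Fin r → ℂ) :=
  ContinuousLinearMap.pi fun k => t ^ w k • ContinuousLinearMap.proj k

@[simp] theorem dilateL_apply {r : ℕ} (w : Fin r → ℕ) (t : ℂ) (x : Fin r → ℂ) :
    dilateL w t x = dilate w t x := by
  ext k; simp [dilateL, dilate]

theorem dilate_dilate {r : ℕ} (w : Fin r → ℕ) (s t : ℂ) (x : Fin r → ℂ) :
    dilate w s (dilate w t x) = dilate w (s * t) x := by
  ext k; simp [dilate, mul_pow, mul_assoc]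

@[simp] theorem dilate_one {r : ℕ} (w : Fin r → ℕ) (x : Fin r → ℂ) : dilate w 1 x = x := by
  ext k; simp [dilate]

@[simp] theorem dilate_zero_right {r : ℕ} (w : Fin r → ℕ) (t : ℂ) :
    dilate w t (0 : Fin r → ℂ) = 0 := by
  ext k; simp [dilate]

theorem continuous_dilateL {r : ℕ} (w : Fin r → ℕ) : Continuous (dilateL w) := by
  have : dilateL w = fun t : ℂ => ∑ k, t ^ w k •
      (ContinuousLinearMap.single ℂ (fun _ : Fin r => ℂ) k).comp
        (ContinuousLinearMap.proj k : (Fin r → ℂ) →L[ℂ] ℂ) := by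
    funext t
    ext x k
    simp [dilate, Finset.sum_apply, Pi.single_apply]
  rw [this]
  fun_prop

theorem norm_dilate_le {r : ℕ} (w : Fin r → ℕ) {t : ℂ} {c : ℝ} (hc : 1 ≤ c) (ht : ‖t‖ ≤ c)
    (x : Fin r → ℂ) : ‖dilate w t x‖ ≤ c ^ (∑ k, w k) * ‖x‖ := by
  refine (pi_norm_le_iff_of_nonneg (by positivity)).2 fun k => ?_
  rw [dilate, norm_mul, norm_pow]
  gcongr
  · calc ‖t‖ ^ w k ≤ c ^ w k := by gcongr
      _ ≤ c ^ (∑ k, w k) := by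
        refine pow_le_pow_right₀ hc ?_
        exact Finset.single_le_sum (f := w) (fun _ _ => Nat.zero_le _) (Finset.mem_univ k)
  · exact norm_le_pi_norm x k

theorem norm_dilate_le_self {r : ℕ} (w : Fin r → ℕ) {t : ℂ} (ht : ‖t‖ ≤ 1)
    (x : Fin r → ℂ) : ‖dilate w t x‖ ≤ ‖x‖ := by
  simpa using norm_dilate_le w le_rfl ht x

theorem norm_dilateL_le {r : ℕ} (w : Fin r → ℕ) {t : ℂ} (ht : ‖t‖ ≤ 1) :
    ‖dilateL w t‖ ≤ 1 :=
  ContinuousLinearMap.opNorm_le_bound _ zero_le_one fun x => by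
    simpa using norm_dilate_le_self w ht x

/-- The weighted radial average `∫₀¹ t ^ m f(t · x) dt` of a function. -/
noncomputable def radialAverage {r : ℕ} (w : Fin r → ℕ) (m : ℕ) (f : (Fin r → ℂ) → ℂ)
    (x : Fin r → ℂ) : ℂ :=
  ∫ t in (0 : ℝ)..1, (t : ℂ) ^ m * f (dilate w t x)

/-- The Taylor series of the radial average is obtained by averaging the Taylor series of `f`
term by term. -/
theorem analyticAt_radialAverage {r : ℕ} (w : Fin r → ℕ) (m : ℕ) {f : (Fin r → ℂ) → ℂ}
    (hf : AnalyticAt ℂ f 0) : AnalyticAt ℂ (radialAverage w m f) 0 := by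
  obtain ⟨p, ρ, hp⟩ := hf
  -- The `n`-th Taylor coefficient of `x ↦ t ^ m f(t · x)`; for `0 < t ≤ 1` its norm is
  -- at most `‖p n‖`.
  let g : ∀ n : ℕ, ℝ → (Fin r → ℂ) [×n]→L[ℂ] ℂ := fun n t =>
    (t : ℂ) ^ m • (p n).compContinuousLinearMap (fun _ => dilateL w (t : ℂ))
  have hgc : ∀ n, Continuous (g n) := by
    intro n
    have h1 : Continuous fun t : ℝ =>
        ContinuousMultilinearMap.compContinuousLinearMapContinuousMultilinear ℂ
          (fun _ : Fin n => Fin r → ℂ) (fun _ : Fin n => Fin r → ℂ) ℂ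
          (fun _ => dilateL w (t : ℂ)) :=
      (ContinuousMultilinearMap.cont _).comp
        (continuous_pi fun _ => (continuous_dilateL w).comp Complex.continuous_ofReal)
    have h2 := h1.clm_apply (continuous_const (y := p n))
    exact (Complex.continuous_ofReal.pow m).smul h2
  have hnorm : ∀ t ∈ Set.uIoc (0 : ℝ) 1, ‖(t : ℂ)‖ ≤ 1 := by
    intro t ht
    rw [Set.uIoc_of_le zero_le_one] at ht
    rw [Complex.norm_real, Real.norm_of_nonneg ht.1.le]
    exact ht.2
  have hgn : ∀ n, ∀ t ∈ Set.uIoc (0 : ℝ) 1, ‖g n t‖ ≤ ‖p n‖ := by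
    intro n t ht
    have h1 := hnorm t ht
    calc ‖g n t‖ ≤ ‖(t : ℂ) ^ m‖ * (‖p n‖ * ∏ _i : Fin n, ‖dilateL w (t : ℂ)‖) := by
          rw [norm_smul]
          gcongr
          exact ContinuousMultilinearMap.norm_compContinuousLinearMap_le _ _
      _ ≤ 1 * (‖p n‖ * ∏ _i : Fin n, 1) := by
          gcongr
          · rw [norm_pow]; exact pow_le_one₀ (norm_nonneg _) h1
          · exact norm_dilateL_le w h1
      _ = ‖p n‖ := by simp
  let q : FormalMultilinearSeries ℂ (Fin r → ℂ) ℂ := fun n => ∫ t in (0 : ℝ)..1, g n t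
  have hqn : ∀ n, ‖q n‖ ≤ ‖p n‖ := fun n => by
    simpa using intervalIntegral.norm_integral_le_of_norm_le_const (hgn n)
  refine ⟨q, ρ, ?_, hp.r_pos, ?_⟩
  · refine hp.r_le.trans (ENNReal.le_of_forall_nnreal_lt fun s hs => ?_)
    obtain ⟨C, -, hC⟩ := p.norm_mul_pow_le_of_lt_radius hs
    exact q.le_radius_of_bound C fun n => by
      refine le_trans ?_ (hC n)
      gcongr
      exact hqn n
  · intro y hy
    have hqy : ∀ n, (q n fun _ => y) = ∫ t in (0 : ℝ)..1, g n t (fun _ => y) := fun n => by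
      have := (ContinuousMultilinearMap.apply ℂ (fun _ : Fin n => Fin r → ℂ) ℂ
        (fun _ => y)).intervalIntegral_comp_comm
          ((hgc n).intervalIntegrable (μ := MeasureTheory.volume) 0 1)
      simpa using this.symm
    have hgy : ∀ n t, g n t (fun _ => y) = (t : ℂ) ^ m * p n (fun _ => dilate w t y) := by
      intro n t; simp [g]
    have hsum : Summable fun n => ‖p n‖ * ‖y‖ ^ n := by
      have hy' : (‖y‖₊ : ENNReal) < p.radius := by
        refine lt_of_lt_of_le ?_ hp.r_le
        simpa [enorm_eq_nnnorm] using hy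
      exact p.summable_norm_mul_pow hy'
    simp only [hqy]
    rw [zero_add, radialAverage]
    simp only [hgy]
    refine intervalIntegral.hasSum_integral_of_dominated_convergence
      (fun n _ => ‖p n‖ * ‖y‖ ^ n) ?_ ?_ ?_ ?_ ?_
    · intro n
      have h3 : Continuous fun t => g n t (fun _ => y) :=
        (ContinuousMultilinearMap.apply ℂ (fun _ : Fin n => Fin r → ℂ) ℂ
          (fun _ => y)).continuous.comp (hgc n)
      simp only [hgy] at h3
      exact h3.aestronglyMeasurable
    · intro n
      refine Eventually.of_forall fun t ht => ?_
      rw [← hgy]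
      refine ((g n t).le_opNorm _).trans ?_
      simp only [Finset.prod_const, Finset.card_univ, Fintype.card_fin]
      gcongr
      exact hgn n t ht
    · exact Eventually.of_forall fun t _ => hsum
    · exact intervalIntegrable_const
    · refine Eventually.of_forall fun t ht => ?_
      have hmem : dilate w t y ∈ Metric.eball (0 : Fin r → ℂ) ρ := by
        rw [mem_eball_zero_iff] at hy ⊢
        refine lt_of_le_of_lt ?_ hy
        rw [enorm_le_iff_norm_le]
        exact norm_dilate_le_self w (hnorm t ht) y
      have := (hp.hasSum hmem).mul_left ((t : ℂ) ^ m)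
      simpa using this

theorem hasDerivAt_dilate {r : ℕ} (w : Fin r → ℕ) (x : Fin r → ℂ) :
    HasDerivAt (fun t : ℂ => dilate w t x) (fun k => (w k : ℂ) * x k) 1 := by
  refine hasDerivAt_pi.2 fun k => ?_
  simpa [dilate] using! (hasDerivAt_pow (w k) (1 : ℂ)).mul_const (x k)

theorem ofReal_pow_mul_radialAverage {r : ℕ} (w : Fin r → ℕ) (m : ℕ) (f : (Fin r → ℂ) → ℂ)
    (t : ℝ) (x : Fin r → ℂ) :
    (t : ℂ) ^ (m + 1) * radialAverage w m f (dilate w t x)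
      = ∫ u in (0 : ℝ)..t, (u : ℂ) ^ m * f (dilate w u x) := by
  have h := intervalIntegral.smul_integral_comp_mul_left (a := 0) (b := 1)
    (fun u : ℝ => (u : ℂ) ^ m * f (dilate w u x)) t
  rw [mul_zero, mul_one] at h
  rw [← h, radialAverage, pow_succ', mul_assoc, Complex.real_smul,
    ← intervalIntegral.integral_const_mul]
  congr 1
  refine intervalIntegral.integral_congr fun u _ => ?_
  simp only [dilate_dilate, Complex.ofReal_mul, mul_pow]
  rw [mul_comm (u : ℂ) t]
  ring

/-- With `E = ∑ w_k x_k ∂_k` the weighted Euler field, the radial average `F` of `f` solves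
`E F + (m + 1) F = f`: this is the derivative at `t = 1` of
`t ^ (m + 1) F(t · x) = ∫₀ᵗ u ^ m f(u · x) du`. -/
theorem fderiv_radialAverage {r : ℕ} (w : Fin r → ℕ) (m : ℕ) {f : (Fin r → ℂ) → ℂ}
    (hf : AnalyticAt ℂ f 0) : ∀ᶠ x in 𝓝 (0 : Fin r → ℂ),
      fderiv ℂ (radialAverage w m f) x (fun k => (w k : ℂ) * x k)
        + (m + 1) * radialAverage w m f x = f x := by
  obtain ⟨ε, hε, hball⟩ := Metric.eventually_nhds_iff_ball.1 hf.eventually_analyticAt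
  filter_upwards [(analyticAt_radialAverage w m hf).eventually_analyticAt,
    Metric.ball_mem_nhds 0 hε] with x hFx hx
  set F := radialAverage w m f
  have hcont : Continuous fun u : ℝ => dilate w (u : ℂ) x := by
    refine continuous_pi fun k => ?_
    simp only [dilate]
    fun_prop
  set S : Set ℝ := {u | dilate w (u : ℂ) x ∈ Metric.ball (0 : Fin r → ℂ) ε}
  have hSopen : IsOpen S := Metric.isOpen_ball.preimage hcont
  have hIS : ∀ u ∈ Set.uIcc (0 : ℝ) 1, u ∈ S := by
    intro u hu
    rw [Set.uIcc_of_le zero_le_one] at hu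
    have hu' : ‖(u : ℂ)‖ ≤ 1 := by
      rw [Complex.norm_real, Real.norm_of_nonneg hu.1]; exact hu.2
    have hx' : ‖x‖ < ε := by simpa using hx
    simpa [S] using (norm_dilate_le_self w hu' x).trans_lt hx'
  have h1S : (1 : ℝ) ∈ S := hIS 1 (by simp)
  have hgS : ContinuousOn (fun u : ℝ => (u : ℂ) ^ m * f (dilate w u x)) S := by
    intro u hu
    refine ContinuousAt.continuousWithinAt (ContinuousAt.mul (by fun_prop) ?_)
    exact ContinuousAt.comp (f := fun u : ℝ => dilate w (u : ℂ) x) (hball _ hu).continuousAt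
      hcont.continuousAt
  have hright : HasDerivAt (fun t : ℝ => ∫ u in (0 : ℝ)..t, (u : ℂ) ^ m * f (dilate w u x))
      (f x) 1 := by
    have := intervalIntegral.integral_hasDerivAt_right
      ((hgS.mono hIS).intervalIntegrable (μ := MeasureTheory.volume))
      (hgS.stronglyMeasurableAtFilter hSopen 1 h1S) (hgS.continuousAt (hSopen.mem_nhds h1S))
    simpa using this
  have hleft : HasDerivAt (fun t : ℂ => t ^ (m + 1) * F (dilate w t x))
      ((m + 1) * F x + fderiv ℂ F x (fun k => (w k : ℂ) * x k)) 1 := by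
    have h1 : HasFDerivAt F (fderiv ℂ F x) (dilate w 1 x) := by
      simpa using hFx.differentiableAt.hasFDerivAt
    have h2 := (hasDerivAt_pow (m + 1) (1 : ℂ)).mul (h1.comp_hasDerivAt 1 (hasDerivAt_dilate w x))
    simpa using! h2
  have hleft' := HasDerivAt.comp_ofReal (z := 1) (by simpa using hleft)
  simp only [F, ofReal_pow_mul_radialAverage] at hleft'
  rw [add_comm]
  exact hleft'.unique hright

theorem radialAverage_zero {r : ℕ} (w : Fin r → ℕ) (m : ℕ) (f : (Fin r → ℂ) → ℂ) :
    (m + 1) * radialAverage w m f 0 = f 0 := by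
  have h : ∫ t in (0 : ℝ)..1, (t : ℂ) ^ m = ((m : ℂ) + 1)⁻¹ := by
    have := integral_pow (a := 0) (b := 1) m
    simp only [one_pow, ne_eq, Nat.add_eq_zero_iff, one_ne_zero, and_false, not_false_eq_true,
      zero_pow, sub_zero, one_div] at this
    simp only [← Complex.ofReal_pow]
    rw [intervalIntegral.integral_ofReal, this]
    push_cast; rfl
  have hm : (m : ℂ) + 1 ≠ 0 := by exact_mod_cast m.succ_ne_zero
  rw [radialAverage]
  simp only [dilate_zero_right]
  rw [intervalIntegral.integral_mul_const, h]
  field_simp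

/-! ### Variable dilations and volume densities -/

/-- The map `x ↦ s(x) · x` that dilates every point by a variable factor `s`. -/
def rescale {r : ℕ} (w : Fin r → ℕ) (s : (Fin r → ℂ) → ℂ) (x : Fin r → ℂ) : Fin r → ℂ :=
  dilate w (s x) x

/-- The derivative of `rescale w s` at a point where `s ≠ 0`: the dilation by `s x` composed with
the rank one perturbation `v ↦ v + (ds v / s) E` of the identity, `E` the Euler field. -/
theorem hasFDerivAt_rescale {r : ℕ} (w : Fin r → ℕ) {s : (Fin r → ℂ) → ℂ} {x : Fin r → ℂ}
    (hs : DifferentiableAt ℂ s x) (h0 : s x ≠ 0) :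
    HasFDerivAt (rescale w s) ((dilateL w (s x)).comp
      (ContinuousLinearMap.id ℂ (Fin r → ℂ) +
        (fderiv ℂ s x).smulRight (fun k => (s x)⁻¹ * ((w k : ℂ) * x k)))) x := by
  refine hasFDerivAt_pi'.2 fun k => ?_
  have h1 := (hs.hasFDerivAt.pow (w k)).mul (hasFDerivAt_apply k x)
  refine h1.congr_fderiv ?_
  ext v
  rcases Nat.eq_zero_or_pos (w k) with hk | hk
  · simp [dilate, hk]
  · obtain ⟨l, hl⟩ := Nat.exists_eq_add_of_lt hk
    simp only [zero_add] at hl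
    simp [dilate, hl]
    field_simp
    ring

theorem det_dilateL {r : ℕ} (w : Fin r → ℕ) (t : ℂ) : (dilateL w t).det = t ^ ∑ k, w k := by
  have h : dilateL w t = ContinuousLinearMap.pi fun k =>
      (t ^ w k • ContinuousLinearMap.id ℂ ℂ).comp (ContinuousLinearMap.proj k) := by
    ext v k; simp [dilate]
  rw [h, ContinuousLinearMap.det_pi]
  simp [ContinuousLinearMap.det, Finset.prod_pow_eq_pow_sum]

theorem det_id_add_smulRight {r : ℕ} (l : (Fin r → ℂ) →L[ℂ] ℂ) (v : Fin r → ℂ) :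
    (ContinuousLinearMap.id ℂ (Fin r → ℂ) + l.smulRight v).det = 1 + l v := by
  exact LinearMap.transvection.det (l : (Fin r → ℂ) →ₗ[ℂ] ℂ) v

theorem det_comp {r : ℕ} (f g : (Fin r → ℂ) →L[ℂ] (Fin r → ℂ)) :
    (f.comp g).det = f.det * g.det :=
  LinearMap.det_comp (f : (Fin r → ℂ) →ₗ[ℂ] (Fin r → ℂ)) g

theorem det_fderiv_rescale {r : ℕ} (w : Fin r → ℕ) {s : (Fin r → ℂ) → ℂ} {x : Fin r → ℂ}
    (hs : DifferentiableAt ℂ s x) (h0 : s x ≠ 0) :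
    (fderiv ℂ (rescale w s) x).det
      = s x ^ (∑ k, w k) * (1 + (s x)⁻¹ * fderiv ℂ s x (fun k => (w k : ℂ) * x k)) := by
  rw [(hasFDerivAt_rescale w hs h0).fderiv, det_comp, det_dilateL, det_id_add_smulRight]
  have : (fun k => (s x)⁻¹ * ((w k : ℂ) * x k)) = (s x)⁻¹ • (fun k => (w k : ℂ) * x k) := rfl
  rw [this, map_smul, smul_eq_mul]

/-- The derivative of `rescale w s` sends the Euler field to `1 + s⁻¹ E s` times the Euler
field. -/
theorem fderiv_rescale_euler {r : ℕ} (w : Fin r → ℕ) {s : (Fin r → ℂ) → ℂ} {x : Fin r → ℂ}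
    (hs : DifferentiableAt ℂ s x) (h0 : s x ≠ 0) :
    fderiv ℂ (rescale w s) x (fun k => (w k : ℂ) * x k)
      = (1 + (s x)⁻¹ * fderiv ℂ s x (fun k => (w k : ℂ) * x k)) •
        (fun k => (w k : ℂ) * rescale w s x k) := by
  rw [(hasFDerivAt_rescale w hs h0).fderiv]
  ext k
  simp [dilate, rescale]
  ring

theorem analyticAt_rescale {r : ℕ} (w : Fin r → ℕ) {s : (Fin r → ℂ) → ℂ}
    (hs : AnalyticAt ℂ s 0) : AnalyticAt ℂ (rescale w s) 0 := by
  refine AnalyticAt.pi fun k => ?_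
  exact (hs.pow (w k)).mul ((ContinuousLinearMap.proj k : (Fin r → ℂ) →L[ℂ] ℂ).analyticAt 0)

@[simp] theorem rescale_zero {r : ℕ} (w : Fin r → ℕ) (s : (Fin r → ℂ) → ℂ) :
    rescale w s (0 : Fin r → ℂ) = 0 := by simp [rescale]

/-- The implicit function theorem for `F(s · x) s ^ N = G(x)`. At `x = 0` the equation reads
`F(0) s ^ N = G(0)`, a polynomial with simple roots. -/
theorem exists_rescale_mul_pow_eq {r : ℕ} (w : Fin r → ℕ) {N : ℕ} (hN : N ≠ 0)
    {F G : (Fin r → ℂ) → ℂ} (hF : AnalyticAt ℂ F 0) (hG : AnalyticAt ℂ G 0)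
    (hF0 : F 0 ≠ 0) (hG0 : G 0 ≠ 0) :
    ∃ s : (Fin r → ℂ) → ℂ, AnalyticAt ℂ s 0 ∧ s 0 ≠ 0 ∧
      ∀ᶠ x in 𝓝 (0 : Fin r → ℂ), F (rescale w s x) * s x ^ N = G x := by
  obtain ⟨s₀, hs₀⟩ := IsAlgClosed.exists_pow_nat_eq (G 0 / F 0) (Nat.pos_of_ne_zero hN)
  have hs₀0 : s₀ ≠ 0 := by
    rintro rfl
    rw [zero_pow hN] at hs₀
    exact div_ne_zero hG0 hF0 hs₀.symm
  let K : (Fin r → ℂ) × ℂ → ℂ := fun u => F (dilate w u.2 u.1) * u.2 ^ N - G u.1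
  have hdil : AnalyticAt ℂ (fun u : (Fin r → ℂ) × ℂ => dilate w u.2 u.1) (0, s₀) := by
    refine AnalyticAt.pi fun k => (analyticAt_snd.pow (w k)).mul ?_
    exact ((ContinuousLinearMap.proj k : (Fin r → ℂ) →L[ℂ] ℂ).analyticAt 0).comp
      (f := fun u : (Fin r → ℂ) × ℂ => u.1) (x := (0, s₀)) analyticAt_fst
  have hK : AnalyticAt ℂ K (0, s₀) := by
    refine ((AnalyticAt.fun_comp (g := F) ?_ hdil).mul (analyticAt_snd.pow N)).sub
      (AnalyticAt.fun_comp (g := G) hG analyticAt_fst)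
    simpa using hF
  have hK0 : K (0, s₀) = 0 := by
    simp only [K, dilate_zero_right, hs₀]
    field_simp
    ring
  have hcd : ContDiffAt ℂ ⊤ K (0, s₀) := hK.contDiffAt
  have hinv : (fderiv ℂ K (0, s₀) ∘L .inr ℂ (Fin r → ℂ) ℂ).IsInvertible := by
    set c : ℂ := F 0 * (N * s₀ ^ (N - 1))
    have hc : c ≠ 0 := mul_ne_zero hF0
      (mul_ne_zero (by exact_mod_cast hN) (pow_ne_zero _ hs₀0))
    have h1 : HasFDerivAt (fun t : ℂ => K (0, t))
        (fderiv ℂ K (0, s₀) ∘L .inr ℂ (Fin r → ℂ) ℂ) s₀ :=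
      HasFDerivAt.comp s₀ hK.differentiableAt.hasFDerivAt (hasFDerivAt_prodMk_right 0 s₀)
    have h2 : HasDerivAt (fun t : ℂ => K (0, t)) c s₀ := by
      simp only [K, dilate_zero_right]
      exact ((hasDerivAt_pow N s₀).const_mul (F 0)).sub_const _
    refine ⟨ContinuousLinearEquiv.unitsEquivAut ℂ (Units.mk0 c hc), ?_⟩
    rw [h1.unique h2.hasFDerivAt]
    ext
    simp
  refine ⟨hcd.implicitFunction (by simp) hinv, ?_, ?_, ?_⟩
  · exact (hcd.contDiffAt_implicitFunction (by simp) hinv).analyticAt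
  · rw [hcd.implicitFunction_apply_self (by simp) hinv]
    exact hs₀0
  · filter_upwards [hcd.eventually_apply_implicitFunction (by simp) hinv] with x hx
    rw [hK0] at hx
    exact sub_eq_zero.1 hx

/-- Any two holomorphic volume densities `f` and `g` differ by a variable weighted dilation. If `F`
and `G` are the radial averages of `f` and `g`, the equation `F(s · x) s ^ N = G` yields
`f(s · x) det D(s · x) = g` on applying `E + N` to both sides. -/
theorem exists_rescale_density {r : ℕ} (w : Fin r → ℕ) (hw : 0 < ∑ k, w k)
    {f g : (Fin r → ℂ) → ℂ} (hf : AnalyticAt ℂ f 0) (hg : AnalyticAt ℂ g 0)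
    (hf0 : f 0 ≠ 0) (hg0 : g 0 ≠ 0) :
    ∃ s : (Fin r → ℂ) → ℂ, AnalyticAt ℂ s 0 ∧ s 0 ≠ 0 ∧
      ∀ᶠ x in 𝓝 (0 : Fin r → ℂ),
        f (rescale w s x) * (fderiv ℂ (rescale w s) x).det = g x := by
  obtain ⟨m, hm⟩ := Nat.exists_eq_succ_of_ne_zero hw.ne'
  have hne : ∀ {h : (Fin r → ℂ) → ℂ}, h 0 ≠ 0 → radialAverage w m h 0 ≠ 0 := by
    intro h h0 h1
    exact h0 (by rw [← radialAverage_zero w m h, h1, mul_zero])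
  have hFa := analyticAt_radialAverage w m hf
  have hGa := analyticAt_radialAverage w m hg
  obtain ⟨s, hs, hs0, hsol⟩ := exists_rescale_mul_pow_eq w (Nat.succ_ne_zero m) hFa hGa
    (hne hf0) (hne hg0)
  refine ⟨s, hs, hs0, ?_⟩
  have htend : Tendsto (rescale w s) (𝓝 0) (𝓝 0) := by
    simpa using (analyticAt_rescale w hs).continuousAt.tendsto
  filter_upwards [hsol.eventually_nhds, fderiv_radialAverage w m hg,
    htend.eventually (fderiv_radialAverage w m hf), htend.eventually hFa.eventually_analyticAt,
    hs.eventually_analyticAt, hs.continuousAt.eventually_ne hs0] with x hsolx hEG hEF hFx hsx hsx0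
  set F := radialAverage w m f
  set G := radialAverage w m g
  set v : Fin r → ℂ := fun k => (w k : ℂ) * x k
  have hd := ((hFx.differentiableAt.hasFDerivAt.comp x
      (hasFDerivAt_rescale w hsx.differentiableAt hsx0).differentiableAt.hasFDerivAt).mul
        (hsx.differentiableAt.hasFDerivAt.pow (m + 1)))
  -- Apply the derivatives of both sides of `F(s · x) s ^ N = G(x)` to the Euler field.
  have hv := congrArg (fun L : (Fin r → ℂ) →L[ℂ] ℂ => L v)
    (hd.congr_of_eventuallyEq (EventuallyEq.symm hsolx)).fderiv
  have heu := fderiv_rescale_euler w hsx.differentiableAt hsx0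
  simp only [add_apply, smul_apply, smul_eq_mul,
    ContinuousLinearMap.comp_apply, Function.comp_apply] at hv
  rw [show fderiv ℂ (rescale w s) x v = _ from heu, map_smul, smul_eq_mul] at hv
  rw [det_fderiv_rescale w hsx.differentiableAt hsx0, hm, Nat.succ_eq_add_one, ← hEF, ← hEG, hv,
    ← hsolx.self_of_nhds]
  simp only [Nat.add_sub_cancel, v, nsmul_eq_mul]
  push_cast
  field_simp
  ring

/-! ### Volume forms, matrix germs and diffeomorphism-germs -/

/-- The coefficient of a top degree form with respect to `dx₁ ∧ … ∧ dx_r`. -/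
noncomputable def density {r : ℕ} (Ω : (Fin r → ℂ) → (Fin r → ℂ) [⋀^Fin r]→L[ℂ] ℂ)
    (x : Fin r → ℂ) : ℂ :=
  Ω x (Pi.basisFun ℂ (Fin r))

theorem eq_iff_apply_basisFun_eq {r : ℕ} (α β : (Fin r → ℂ) [⋀^Fin r]→L[ℂ] ℂ) :
    α = β ↔ α (Pi.basisFun ℂ (Fin r)) = β (Pi.basisFun ℂ (Fin r)) := by
  refine ⟨fun h => by rw [h], fun h => ?_⟩
  apply ContinuousAlternatingMap.toAlternatingMap_injective
  rw [α.toAlternatingMap.eq_smul_basis_det (Pi.basisFun ℂ (Fin r)),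
    β.toAlternatingMap.eq_smul_basis_det (Pi.basisFun ℂ (Fin r))]
  exact congrArg (· • _) h

theorem density_pullback {r : ℕ} (Φ : (Fin r → ℂ) → (Fin r → ℂ))
    (Ω : (Fin r → ℂ) → (Fin r → ℂ) [⋀^Fin r]→L[ℂ] ℂ) (x : Fin r → ℂ) :
    density (pullback Φ Ω) x = density Ω (Φ x) * (fderiv ℂ Φ x).det := by
  have h := congrArg (fun a => a (fun i => fderiv ℂ Φ x (Pi.basisFun ℂ (Fin r) i)))
    ((Ω (Φ x)).toAlternatingMap.eq_smul_basis_det (Pi.basisFun ℂ (Fin r)))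
  have hdet : (Pi.basisFun ℂ (Fin r)).det (fun i => fderiv ℂ Φ x (Pi.basisFun ℂ (Fin r) i))
      = (fderiv ℂ Φ x).det := by
    have := Module.Basis.det_comp (Pi.basisFun ℂ (Fin r))
      (fderiv ℂ Φ x : (Fin r → ℂ) →ₗ[ℂ] (Fin r → ℂ)) (Pi.basisFun ℂ (Fin r))
    rw [Module.Basis.det_self, mul_one] at this
    exact this
  rw [AlternatingMap.smul_apply, hdet] at h
  exact h

theorem pullback_eq_iff {r : ℕ} (Φ : (Fin r → ℂ) → (Fin r → ℂ))
    (Ω : (Fin r → ℂ) → (Fin r → ℂ) [⋀^Fin r]→L[ℂ] ℂ) (x : Fin r → ℂ) :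
    pullback Φ Ω x = Ω x ↔ density Ω (Φ x) * (fderiv ℂ Φ x).det = density Ω x := by
  rw [← density_pullback]
  exact eq_iff_apply_basisFun_eq _ _

theorem IsVolumeFormGerm.analyticAt_density {r : ℕ}
    {Ω : (Fin r → ℂ) → (Fin r → ℂ) [⋀^Fin r]→L[ℂ] ℂ} (hΩ : IsVolumeFormGerm Ω) :
    AnalyticAt ℂ (density Ω) 0 :=
  ((ContinuousAlternatingMap.apply ℂ (Fin r → ℂ) ℂ
    (Pi.basisFun ℂ (Fin r) : Fin r → Fin r → ℂ)).analyticAt _).comp hΩ.hol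

theorem IsVolumeFormGerm.density_ne_zero {r : ℕ}
    {Ω : (Fin r → ℂ) → (Fin r → ℂ) [⋀^Fin r]→L[ℂ] ℂ} (hΩ : IsVolumeFormGerm Ω) :
    density Ω 0 ≠ 0 := fun h =>
  hΩ.ne_zero.self_of_nhds ((eq_iff_apply_basisFun_eq (Ω 0) 0).2 (by simpa using! h))

theorem IsHolMatrixGerm.mul {r n : ℕ} {X Y : (Fin r → ℂ) → Matrix (Fin n) (Fin n) ℂ}
    (hX : IsHolMatrixGerm X) (hY : IsHolMatrixGerm Y) :
    IsHolMatrixGerm fun x => X x * Y x := by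
  intro i j
  simp only [Matrix.mul_apply]
  exact Finset.analyticAt_fun_sum _ fun k _ => (hX i k).mul (hY k j)

theorem IsHolMatrixGerm.transpose {r n : ℕ} {X : (Fin r → ℂ) → Matrix (Fin n) (Fin n) ℂ}
    (hX : IsHolMatrixGerm X) : IsHolMatrixGerm fun x => (X x)ᵀ :=
  fun i j => hX j i

theorem IsHolMatrixGerm.comp {r n : ℕ} {X : (Fin r → ℂ) → Matrix (Fin n) (Fin n) ℂ}
    (hX : IsHolMatrixGerm X) {Φ : (Fin r → ℂ) → (Fin r → ℂ)} (hΦ : AnalyticAt ℂ Φ 0)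
    (h0 : Φ 0 = 0) : IsHolMatrixGerm fun x => X (Φ x) :=
  fun i j => AnalyticAt.fun_comp (g := fun x => X x i j) (by rw [h0]; exact hX i j) hΦ

theorem analyticAt_det {ι E : Type*} [Fintype ι] [DecidableEq ι] [NormedAddCommGroup E]
    [NormedSpace ℂ E] {X : E → Matrix ι ι ℂ} {a : E}
    (hX : ∀ i j, AnalyticAt ℂ (fun x => X x i j) a) : AnalyticAt ℂ (fun x => (X x).det) a := by
  simp only [Matrix.det_apply']
  exact Finset.analyticAt_fun_sum _ fun σ _ =>
    analyticAt_const.mul (Finset.analyticAt_fun_prod _ fun i _ => hX _ _)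

theorem IsGLGerm.mul {r n : ℕ} {X Y : (Fin r → ℂ) → Matrix (Fin n) (Fin n) ℂ}
    (hX : IsGLGerm X) (hY : IsGLGerm Y) : IsGLGerm fun x => X x * Y x :=
  ⟨hX.hol.mul hY.hol, by
    filter_upwards [hX.inv, hY.inv] with x h1 h2 using h1.mul h2⟩

theorem IsGLGerm.comp {r n : ℕ} {X : (Fin r → ℂ) → Matrix (Fin n) (Fin n) ℂ}
    (hX : IsGLGerm X) {Φ : (Fin r → ℂ) → (Fin r → ℂ)} (hΦ : AnalyticAt ℂ Φ 0)
    (h0 : Φ 0 = 0) : IsGLGerm fun x => X (Φ x) :=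
  ⟨hX.hol.comp hΦ h0, (show Tendsto Φ (𝓝 0) (𝓝 0) by
    simpa [h0] using hΦ.continuousAt.tendsto).eventually hX.inv⟩

/-- Inverses are holomorphic by Cramer's rule. -/
theorem IsGLGerm.inverse {r n : ℕ} {X : (Fin r → ℂ) → Matrix (Fin n) (Fin n) ℂ}
    (hX : IsGLGerm X) : IsGLGerm fun x => (X x)⁻¹ := by
  refine ⟨fun i j => ?_, hX.inv.mono fun x hx => ?_⟩
  · simp only [Matrix.inv_def, Matrix.smul_apply, Matrix.adjugate_apply, Ring.inverse_eq_inv',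
      smul_eq_mul]
    refine (AnalyticAt.fun_inv (analyticAt_det hX.hol) ?_).mul (analyticAt_det fun k l => ?_)
    · have := (Matrix.isUnit_iff_isUnit_det _).1 hX.inv.self_of_nhds
      exact this.ne_zero
    · simp only [Matrix.updateRow_apply]
      split_ifs
      · exact analyticAt_const
      · exact hX.hol k l
  · exact (Matrix.isUnit_nonsing_inv_iff).2 hx

theorem IsDiffeoGerm.tendsto {r : ℕ} {Φ : (Fin r → ℂ) → (Fin r → ℂ)} (hΦ : IsDiffeoGerm Φ) :
    Tendsto Φ (𝓝 0) (𝓝 0) := by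
  simpa [hΦ.map_zero] using hΦ.hol.continuousAt.tendsto

theorem IsDiffeoGerm.comp {r : ℕ} {Φ Ψ : (Fin r → ℂ) → (Fin r → ℂ)} (hΦ : IsDiffeoGerm Φ)
    (hΨ : IsDiffeoGerm Ψ) : IsDiffeoGerm fun x => Φ (Ψ x) := by
  obtain ⟨Φ', hΦ', hΦ0, hΦl, hΦr⟩ := hΦ.exists_inv
  obtain ⟨Ψ', hΨ', hΨ0, hΨl, hΨr⟩ := hΨ.exists_inv
  refine ⟨AnalyticAt.fun_comp (by rw [hΨ.map_zero]; exact hΦ.hol) hΨ.hol,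
    by rw [hΨ.map_zero, hΦ.map_zero], fun x => Ψ' (Φ' x),
    AnalyticAt.fun_comp (by rw [hΦ0]; exact hΨ') hΦ', by simp only [hΦ0, hΨ0], ?_, ?_⟩
  · filter_upwards [hΨ.tendsto.eventually hΦl, hΨl] with x h1 h2
    rw [h1, h2]
  · have : Tendsto Φ' (𝓝 0) (𝓝 0) := by simpa [hΦ0] using hΦ'.continuousAt.tendsto
    filter_upwards [this.eventually hΨr, hΦr] with x h1 h2
    rw [h1, h2]

theorem IsDiffeoGerm.exists_inverse {r : ℕ} {Φ : (Fin r → ℂ) → (Fin r → ℂ)}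
    (hΦ : IsDiffeoGerm Φ) : ∃ Ψ : (Fin r → ℂ) → (Fin r → ℂ), IsDiffeoGerm Ψ ∧
      (∀ᶠ x in 𝓝 (0 : Fin r → ℂ), Ψ (Φ x) = x) ∧ ∀ᶠ x in 𝓝 (0 : Fin r → ℂ), Φ (Ψ x) = x := by
  obtain ⟨Ψ, hΨ, hΨ0, hl, hr⟩ := hΦ.exists_inv
  exact ⟨Ψ, ⟨hΨ, hΨ0, Φ, hΦ.hol, hΦ.map_zero, hr, hl⟩, hl, hr⟩

theorem det_fderiv_comp {r : ℕ} {Φ Ψ : (Fin r → ℂ) → (Fin r → ℂ)} {x : Fin r → ℂ}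
    (hΦ : DifferentiableAt ℂ Φ (Ψ x)) (hΨ : DifferentiableAt ℂ Ψ x) :
    (fderiv ℂ (fun y => Φ (Ψ y)) x).det = (fderiv ℂ Φ (Ψ x)).det * (fderiv ℂ Ψ x).det := by
  rw [fderiv_fun_comp x hΦ hΨ, det_comp]

theorem det_fderiv_mul_det_fderiv_eq_one {r : ℕ} {Φ Ψ : (Fin r → ℂ) → (Fin r → ℂ)}
    {x : Fin r → ℂ} (hΦ : DifferentiableAt ℂ Φ (Ψ x)) (hΨ : DifferentiableAt ℂ Ψ x)
    (h : ∀ᶠ y in 𝓝 x, Φ (Ψ y) = y) :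
    (fderiv ℂ Φ (Ψ x)).det * (fderiv ℂ Ψ x).det = 1 := by
  rw [← det_fderiv_comp hΦ hΨ, EventuallyEq.fderiv_eq (f := fun y => y) h, fderiv_fun_id]
  exact LinearMap.det_id

theorem IsDiffeoGerm.det_fderiv_ne_zero {r : ℕ} {Φ : (Fin r → ℂ) → (Fin r → ℂ)}
    (hΦ : IsDiffeoGerm Φ) : (fderiv ℂ Φ 0).det ≠ 0 := by
  obtain ⟨Ψ, hΨ, -, hr⟩ := hΦ.exists_inverse
  have h := det_fderiv_mul_det_fderiv_eq_one (Φ := Φ) (Ψ := Ψ) (x := 0)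
    (by rw [hΨ.map_zero]; exact hΦ.hol.differentiableAt) hΨ.hol.differentiableAt hr
  rw [hΨ.map_zero] at h
  exact left_ne_zero_of_mul_eq_one h

/-- The holomorphic inverse function theorem for germs. -/
theorem isDiffeoGerm_of_det_ne_zero {r : ℕ} {Φ : (Fin r → ℂ) → (Fin r → ℂ)}
    (hΦ : AnalyticAt ℂ Φ 0) (h0 : Φ 0 = 0) (hdet : (fderiv ℂ Φ 0).det ≠ 0) :
    IsDiffeoGerm Φ := by
  let e : (Fin r → ℂ) ≃L[ℂ] (Fin r → ℂ) :=
    (fderiv ℂ Φ 0).toContinuousLinearEquivOfDetNeZero hdet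
  have he : HasFDerivAt Φ (e : (Fin r → ℂ) →L[ℂ] (Fin r → ℂ)) 0 := by
    simpa [e] using hΦ.differentiableAt.hasFDerivAt
  have hcd : ContDiffAt ℂ ⊤ Φ 0 := hΦ.contDiffAt
  have hs := hcd.hasStrictFDerivAt' he (by simp)
  refine ⟨hΦ, h0, hcd.localInverse he (by simp), ?_, ?_, ?_, ?_⟩
  · have := (hcd.to_localInverse he (by simp)).analyticAt
    rwa [h0] at this
  · have := hcd.localInverse_apply_image he (by simp)
    rwa [h0] at this
  · exact hs.eventually_left_inverse
  · have := hs.eventually_right_inverse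
    rwa [h0] at this

/-- The Jacobian determinant of a diffeomorphism-germ times a unit pulled back along it is again a
holomorphic unit. -/
theorem IsDiffeoGerm.analyticAt_mul_det {r : ℕ} {Φ : (Fin r → ℂ) → (Fin r → ℂ)}
    (hΦ : IsDiffeoGerm Φ) {f : (Fin r → ℂ) → ℂ} (hf : AnalyticAt ℂ f 0) (hf0 : f 0 ≠ 0) :
    AnalyticAt ℂ (fun x => f (Φ x) * (fderiv ℂ Φ x).det) 0 ∧
      f (Φ 0) * (fderiv ℂ Φ 0).det ≠ 0 := by
  refine ⟨(AnalyticAt.fun_comp (by rwa [hΦ.map_zero]) hΦ.hol).mul ?_,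
    mul_ne_zero (by rwa [hΦ.map_zero]) hΦ.det_fderiv_ne_zero⟩
  have h : (fun x => (fderiv ℂ Φ x).det) = fun x =>
      (LinearMap.toMatrix' (fderiv ℂ Φ x : (Fin r → ℂ) →ₗ[ℂ] (Fin r → ℂ))).det := by
    funext x
    rw [LinearMap.det_toMatrix']
  rw [h]
  refine analyticAt_det fun i j => ?_
  have := ((ContinuousLinearMap.proj i : (Fin r → ℂ) →L[ℂ] ℂ).comp
    (ContinuousLinearMap.apply ℂ (Fin r → ℂ) (Pi.single j (1 : ℂ)))).analyticAt
      (fderiv ℂ Φ 0) |>.comp hΦ.hol.fderiv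
  refine this.congr (Eventually.of_forall fun x => ?_)
  simp [LinearMap.toMatrix'_apply]

/-! ### Quasi-homogeneous matrix germs -/

/-- Homogeneity under each single dilation, as an identity of germs whose neighbourhood may depend
on `t`, holds on a common neighbourhood for all bounded `t`, by the identity theorem on a ball. -/
theorem eventually_forall_dilate_eq {r : ℕ} (w : Fin r → ℕ) {c : (Fin r → ℂ) → ℂ} {χ : ℂ → ℂ}
    (hc : AnalyticAt ℂ c 0)
    (h : ∀ t, ∀ᶠ x in 𝓝 (0 : Fin r → ℂ), c (dilate w t x) = χ t * c x) (R : ℝ) :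
    ∀ᶠ x in 𝓝 (0 : Fin r → ℂ), ∀ t : ℂ, ‖t‖ ≤ R → c (dilate w t x) = χ t * c x := by
  obtain ⟨ε, hε, hball⟩ := Metric.eventually_nhds_iff_ball.1 hc.eventually_analyticAt
  -- A common bound for the norms of the dilations by `t` with `‖t‖ ≤ R`.
  set M : ℝ := max R 1 ^ ∑ k, w k
  have hM1 : 1 ≤ M := one_le_pow₀ (le_max_right R 1)
  have hM : 0 < M := zero_lt_one.trans_le hM1
  have hεM : 0 < ε / M := div_pos hε hM
  filter_upwards [Metric.ball_mem_nhds 0 hεM] with x hx t ht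
  have hmaps : ∀ y ∈ Metric.ball (0 : Fin r → ℂ) (ε / M), dilateL w t y ∈ Metric.ball 0 ε := by
    intro y hy
    rw [mem_ball_zero_iff, lt_div_iff₀ hM] at hy
    rw [mem_ball_zero_iff, dilateL_apply]
    calc ‖dilate w t y‖ ≤ M * ‖y‖ :=
          norm_dilate_le w (le_max_right R 1) (ht.trans (le_max_left R 1)) y
      _ < ε := by rwa [mul_comm]
  have hsub : Metric.ball (0 : Fin r → ℂ) (ε / M) ⊆ Metric.ball 0 ε :=
    Metric.ball_subset_ball (div_le_self hε.le hM1)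
  have h1 : AnalyticOnNhd ℂ (fun y => c (dilateL w t y)) (Metric.ball 0 (ε / M)) := fun y hy =>
    AnalyticAt.fun_comp (g := c) (hball _ (hmaps y hy)) ((dilateL w t).analyticAt y)
  have h2 : AnalyticOnNhd ℂ (fun y => χ t * c y) (Metric.ball 0 (ε / M)) := fun y hy =>
    analyticAt_const.mul (hball _ (hsub hy))
  have := h1.eqOn_of_preconnected_of_eventuallyEq h2 (convex_ball _ _).isPreconnected
    (Metric.mem_ball_self hεM) (by simpa [EventuallyEq] using h t) hx
  simpa using this

/-- Passing to doubled weights removes the half-integral exponents. If `a + b` is odd the germ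
vanishes: applying the dilation by `-1` twice multiplies it by `(-1) ^ (a + b) = -1`. -/
theorem eventually_dilate_two_mul_eq {r : ℕ} (w : Fin r → ℕ) {c : (Fin r → ℂ) → ℂ} (a b : ℕ)
    (hc : AnalyticAt ℂ c 0)
    (h : ∀ t : ℂ, ∀ᶠ x in 𝓝 (0 : Fin r → ℂ),
      c (dilate w t x) = t ^ (((a : ℂ) + (b : ℂ)) / 2) * c x) (R : ℝ) :
    ∀ᶠ x in 𝓝 (0 : Fin r → ℂ), ∀ s : ℂ, ‖s‖ ≤ R →
      c (dilate (fun k => 2 * w k) s x) = s ^ a * c x * s ^ b := by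
  have hdil : ∀ (s : ℂ) (x : Fin r → ℂ), dilate (fun k => 2 * w k) s x = dilate w (s ^ 2) x := by
    intro s x
    ext k
    simp only [dilate, pow_mul]
  simp only [hdil]
  have hunif := fun R' => eventually_forall_dilate_eq w hc h R'
  have hsq : ∀ s : ℂ, ‖s‖ ≤ R → ‖s ^ 2‖ ≤ R ^ 2 := fun s hs => by
    rw [norm_pow]
    gcongr
  rcases Nat.even_or_odd' (a + b) with ⟨m, hm | hm⟩
  · have hexp : ((a : ℂ) + (b : ℂ)) / 2 = (m : ℕ) := by
      have : ((a + b : ℕ) : ℂ) = ((2 * m : ℕ) : ℂ) := by rw [hm]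
      push_cast at this
      rw [this]
      ring
    filter_upwards [hunif (R ^ 2)] with x hx s hs
    rw [hx (s ^ 2) (hsq s hs), hexp, Complex.cpow_natCast, ← pow_mul, ← hm, pow_add]
    ring
  · have hexp : ((-1 : ℂ) ^ (((a : ℂ) + (b : ℂ)) / 2)) * (-1 : ℂ) ^ (((a : ℂ) + (b : ℂ)) / 2)
        = -1 := by
      have h1 : ((a + b : ℕ) : ℂ) = ((2 * m + 1 : ℕ) : ℂ) := by rw [hm]
      push_cast at h1
      rw [← Complex.cpow_add _ _ (by norm_num), add_halves, h1]
      have : (2 * (m : ℂ) + 1) = ((2 * m + 1 : ℕ) : ℂ) := by push_cast; ring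
      rw [this, Complex.cpow_natCast, pow_succ, pow_mul]
      simp
    have htend : Tendsto (fun x : Fin r → ℂ => dilate w (-1) x) (𝓝 0) (𝓝 0) := by
      simpa [Function.comp_def, ← dilateL_apply] using (dilateL w (-1)).continuous.tendsto 0
    have hzero : ∀ᶠ x in 𝓝 (0 : Fin r → ℂ), c x = 0 := by
      filter_upwards [h (-1), htend.eventually (h (-1))] with x h1 h2
      rw [dilate_dilate, neg_mul_neg, one_mul, dilate_one, h1, ← mul_assoc, hexp] at h2
      have h3 : 2 * c x = 0 := by linear_combination h2
      simpa using h3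
    filter_upwards [hunif (R ^ 2), hzero] with x hx h0 s hs
    rw [hx (s ^ 2) (hsq s hs), h0]
    simp

theorem isGLGerm_diagonal_pow {r n : ℕ} {s : (Fin r → ℂ) → ℂ} (hs : AnalyticAt ℂ s 0)
    (hs0 : s 0 ≠ 0) (δ : Fin n → ℕ) :
    IsGLGerm fun x => Matrix.diagonal fun i => s x ^ δ i := by
  refine ⟨fun i j => ?_, ?_⟩
  · by_cases hij : i = j
    · subst hij
      simpa using! hs.pow (δ i)
    · simpa [Matrix.diagonal_apply_ne _ hij] using analyticAt_const
  · filter_upwards [hs.continuousAt.eventually_ne hs0] with x hx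
    rw [Matrix.isUnit_iff_isUnit_det, Matrix.det_diagonal, isUnit_iff_ne_zero]
    exact Finset.prod_ne_zero_iff.2 fun i _ => pow_ne_zero _ hx

/-- A quasi-homogeneous matrix germ changes under a variable dilation by the congruence with
`diag(s ^ δ_i)`. -/
theorem eventually_rescale_eq_diagonal_mul {r n : ℕ} (w : Fin r → ℕ) (δ : Fin n → ℕ)
    {C : (Fin r → ℂ) → Matrix (Fin n) (Fin n) ℂ} (hC : IsHolMatrixGerm C)
    (h : ∀ (t : ℂ) (i j : Fin n), ∀ᶠ x in 𝓝 (0 : Fin r → ℂ),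
      C (dilate w t x) i j = t ^ (((δ i : ℂ) + (δ j : ℂ)) / 2) * C x i j)
    {s : (Fin r → ℂ) → ℂ} (hs : ContinuousAt s 0) :
    ∀ᶠ x in 𝓝 (0 : Fin r → ℂ), C (rescale (fun k => 2 * w k) s x)
      = (Matrix.diagonal fun i => s x ^ δ i)ᵀ * C x * Matrix.diagonal fun i => s x ^ δ i := by
  have hent : ∀ i j, ∀ᶠ x in 𝓝 (0 : Fin r → ℂ), ∀ z : ℂ, ‖z‖ ≤ ‖s 0‖ + 1 →
      C (dilate (fun k => 2 * w k) z x) i j = z ^ δ i * C x i j * z ^ δ j := fun i j =>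
    eventually_dilate_two_mul_eq w (δ i) (δ j) (hC i j) (fun t => h t i j) _
  filter_upwards [eventually_all.2 fun i => eventually_all.2 (hent i),
    hs.norm.eventually_lt continuousAt_const (lt_add_one ‖s 0‖)] with x hx hsx
  ext i j
  rw [rescale, hx i j (s x) hsx.le, Matrix.diagonal_transpose, Matrix.mul_diagonal,
    Matrix.diagonal_mul]

theorem isDiffeoGerm_rescale {r : ℕ} (w : Fin r → ℕ) {s : (Fin r → ℂ) → ℂ}
    (hs : AnalyticAt ℂ s 0) (hs0 : s 0 ≠ 0) : IsDiffeoGerm (rescale w s) := by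
  refine isDiffeoGerm_of_det_ne_zero (analyticAt_rescale w hs) (rescale_zero w s) ?_
  rw [det_fderiv_rescale w hs.differentiableAt hs0]
  have : (fun k => (w k : ℂ) * (0 : Fin r → ℂ) k) = 0 := by ext; simp
  rw [this, map_zero]
  simpa using fun h => absurd h hs0

theorem eq_congr_inv_of_congr_eq {n : ℕ} {P Q Z : Matrix (Fin n) (Fin n) ℂ} (hZ : IsUnit Z)
    (h : P = Zᵀ * Q * Z) : Q = (Z⁻¹)ᵀ * P * Z⁻¹ := by
  have hd := (Matrix.isUnit_iff_isUnit_det _).1 hZ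
  have h1 : Z * Z⁻¹ = 1 := Matrix.mul_nonsing_inv _ hd
  have h2 : (Z⁻¹)ᵀ * Zᵀ = 1 := by rw [← Matrix.transpose_mul, h1, Matrix.transpose_one]
  calc Q = ((Z⁻¹)ᵀ * Zᵀ) * Q * (Z * Z⁻¹) := by rw [h1, h2]; simp
    _ = (Z⁻¹)ᵀ * P * Z⁻¹ := by rw [h]; simp only [Matrix.mul_assoc]

end SymGerm

/-! ### Volume-preserving equivalence -/

theorem mainTheorem3 (r n : ℕ)
    (Ω : (Fin r → ℂ) → (Fin r → ℂ) [⋀^Fin r]→L[ℂ] ℂ) (hΩ : SymGerm.IsVolumeFormGerm Ω)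
    (A : (Fin r → ℂ) → Matrix (Fin n) (Fin n) ℂ) (hA : SymGerm.IsSymGerm A)
    (hqh : SymGerm.IsSymmQuasiHom A)
    (B : (Fin r → ℂ) → Matrix (Fin n) (Fin n) ℂ) (hB : SymGerm.IsSymGerm B)
    (hBA : SymGerm.GEquiv B A) :
    SymGerm.VolEquiv Ω B A := by
  open SymGerm in
  obtain ⟨Φ, X₁, hΦ, hX₁, hABΦ⟩ := hBA
  obtain ⟨φ, lam, δ, X, A', hφ, hX, hlam, hA', hhom⟩ := hqh
  obtain ⟨ψ, hψ, hψφ, hφψ⟩ := hφ.exists_inverse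
  set C : (Fin r → ℂ) → Matrix (Fin n) (Fin n) ℂ := fun x => A' (φ x) with hCdef
  have hC : IsHolMatrixGerm C := by
    have h1 : IsHolMatrixGerm fun x => (X x)ᵀ * A x * X x :=
      (hX.hol.transpose.mul hA.hol).mul hX.hol
    simp only [hCdef, hA']
    exact h1.comp hφ.hol hφ.map_zero
  -- The two volume forms to be matched, in the quasi-homogeneous coordinates.
  have hΦφ : IsDiffeoGerm fun x => Φ (φ x) := hΦ.comp hφ
  obtain ⟨hfa, hf0⟩ := hΦφ.analyticAt_mul_det hΩ.analyticAt_density hΩ.density_ne_zero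
  obtain ⟨hga, hg0⟩ := hφ.analyticAt_mul_det hΩ.analyticAt_density hΩ.density_ne_zero
  -- The doubled weights allow the substitution `t = s ^ 2`, which needs no branch of `t ^ (1 / 2)`.
  have hw : 0 < ∑ k, 2 * lam k := by rw [← Finset.mul_sum]; positivity
  obtain ⟨s, hs, hs0, hsol⟩ := exists_rescale_density (fun k => 2 * lam k) hw hfa hga hf0 hg0
  set θ := rescale (fun k => 2 * lam k) s
  have hθ : IsDiffeoGerm θ := isDiffeoGerm_rescale _ hs hs0
  have hCθ := eventually_rescale_eq_diagonal_mul lam δ hC hhom hs.continuousAt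
  have hD := isGLGerm_diagonal_pow hs hs0 δ
  set D : (Fin r → ℂ) → Matrix (Fin n) (Fin n) ℂ := fun x => Matrix.diagonal fun i => s x ^ δ i
  have hθψ : IsDiffeoGerm fun y => θ (ψ y) := hθ.comp hψ
  have hz : IsDiffeoGerm fun y => φ (θ (ψ y)) := hφ.comp hθψ
  -- With `x = ψ y` and `z = φ (θ x)`, the germs `A y`, `C x`, `C (θ x)`, `A z` and `B (Φ z)` are
  -- successively congruent; the matrix below is the product of the congruences.
  refine ⟨fun y => Φ (φ (θ (ψ y))),
    fun y => X₁ (φ (θ (ψ y))) * (X (φ (θ (ψ y))) * ((D (ψ y))⁻¹ * (X y)⁻¹)),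
    hΦ.comp hz, ?_, ?_, ?_⟩
  · filter_upwards [hψ.tendsto.eventually hsol, hφψ.eventually_nhds,
      hψ.hol.eventually_analyticAt, hψ.tendsto.eventually hφ.hol.eventually_analyticAt,
      hψ.tendsto.eventually hθ.hol.eventually_analyticAt,
      hθψ.tendsto.eventually hΦφ.hol.eventually_analyticAt] with y hsoly hy hψy hφy hθy hΦφy
    rw [pullback_eq_iff]
    have hθψy : DifferentiableAt ℂ (fun y => θ (ψ y)) y :=
      DifferentiableAt.fun_comp' y hθy.differentiableAt hψy.differentiableAt
    have h1 := det_fderiv_comp (Φ := fun x => Φ (φ x)) (Ψ := fun y => θ (ψ y))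
      hΦφy.differentiableAt hθψy
    have h2 := det_fderiv_comp (Φ := θ) (Ψ := ψ) hθy.differentiableAt hψy.differentiableAt
    have h3 := det_fderiv_mul_det_fderiv_eq_one hφy.differentiableAt hψy.differentiableAt hy
    rw [h1, h2]
    rw [hy.self_of_nhds] at hsoly
    linear_combination (fderiv ℂ ψ y).det * hsoly + density Ω y * h3
  · exact (hX₁.comp hz.hol hz.map_zero).mul ((hX.comp hz.hol hz.map_zero).mul
      ((hD.comp hψ.hol hψ.map_zero).inverse.mul hX.inverse))
  · filter_upwards [hψ.tendsto.eventually hCθ, hφψ, hz.tendsto.eventually hABΦ, hX.inv,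
      hψ.tendsto.eventually hD.inv] with y hCy hy hAz hXy hDy
    have e1 := eq_congr_inv_of_congr_eq hDy hCy
    have e2 := eq_congr_inv_of_congr_eq hXy (hA' y)
    simp only [hCdef, hy] at e1
    have e3 := hA' (φ (θ (ψ y)))
    rw [e2, e1, e3, hAz]
    simp only [Matrix.transpose_mul, Matrix.mul_assoc]
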